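/- Let $G = S_\infty$ be the group of all permutations of $\omega = \{0,1,2,\dots\}$. For $m \in \omega$ put $A_m = \{0,\dots,m-1\}$ and let $H_m$ be the set of all injections $A_m \to \omega$. Identify a subset $T \subseteq H_m$ with its characteristic function $\chi_T \in 2^{H_m}$, where $2^{H_m} = \{0,1\}^{H_m}$ carries the product topology, and let $G$ act on $2^{H_m}$ on the right by $(\varphi\cdot g)(f) = \varphi(g\circ f)$. A nonempty closed $G$-invariant subset of $2^{H_m}$ is a minimal flow if the $G$-orbit of each of its points is dense in it. A set $S \subseteq H_m$ is called minimal if $\overline{\chi_S\cdot G}$ is a minimal flow. Let $B_m$ be the Boolean algebra of subsets of $H_m$ generated by the minimal subsets of $H_m$. For $T\subseteq H_m$ and $n \ge m$ let $i^n_m(T) = \{s \in H_n : s|_{A_m} \in T\}$, and let $B_m'$ be the Boolean algebra $\{T \subseteq H_m : \exists\, n \ge m \ \ i^n_m(T) \in B_n\}$. Then for every $m \ge 2$, $B_m'$ is a meager subset of $2^{H_m}$. In particular, the set $\{T \subseteq H_m : \overline{\chi_T\cdot G} = 2^{H_m}\}$ is a dense $G_\delta$ subset of $2^{H_m}$, and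 no member of it belongs to $B_m'$. -/

import Mathlib

namespace SInfFlow

/-- The group `S_∞` of all permutations of `ω`. -/
abbrev SInf : Type := Equiv.Perm ℕ

/-- `H_m`: all injections of `A_m = {0, …, m - 1}` into `ω` (equivalently, the cosets of the
pointwise stabilizer of `A_m`).  `SInf` acts on it on the left by `g • x = g ∘ x`. -/
abbrev H (m : ℕ) : Type := Fin m ↪ ℕ

/-- `2^{H_m}` with the product topology and its pointwise Boolean algebra structure; its elements
are the (characteristic functions of) subsets of `H_m`. -/
abbrev Cantor (m : ℕ) : Type := H m → Bool

/-- The right shift action of `SInf` on `2^{H_m}`, `(φ · g) f = φ (g ∘ f)`, which is the action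
of Mathlib's `SInfᵈᵐᵃ` (the opposite group of `SInf`). -/
theorem shift_apply {m : ℕ} (g : SInf) (φ : Cantor m) (f : H m) :
    (DomMulAct.mk g • φ) f = φ (f.trans g.toEmbedding) := rfl

/-- `φ · S_∞`. -/
abbrev orb {m : ℕ} (φ : Cantor m) : Set (Cantor m) := MulAction.orbit (DomMulAct SInf) φ

/-- `Y ⊆ 2^{H_m}` is a minimal flow: a nonempty closed invariant set in which every orbit
is dense. -/
structure IsMinimalFlow {m : ℕ} (Y : Set (Cantor m)) : Prop where
  nonempty : Y.Nonempty
  isClosed : IsClosed Y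
  invariant : ∀ g : DomMulAct SInf, ∀ y ∈ Y, g • y ∈ Y
  dense_orbit : ∀ y ∈ Y, Y ⊆ closure (orb y)

/-- `S ⊆ H_m` is minimal if the orbit closure of its characteristic function is a minimal flow. -/
def IsMinimalSet {m : ℕ} (S : Cantor m) : Prop := IsMinimalFlow (closure (orb S))

/-- For an embedding `f` of `A_m` into `A_n` and `T ⊆ H_m`,
the set `f(T) = {s ∈ H_n : s ∘ f ∈ T}`. -/
def lift {m n : ℕ} (f : Fin m ↪ Fin n) (T : Cantor m) : Cantor n := fun s => T (f.trans s)

/-- The inclusion `i^n_m` of `A_m` into `A_n`. -/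
abbrev incl {m n : ℕ} (h : m ≤ n) : Fin m ↪ Fin n := Fin.castLEEmb h

/-- `B_m`: the Boolean algebra of subsets of `H_m` generated by the minimal subsets. -/
def B (m : ℕ) : BooleanSubalgebra (Cantor m) :=
  BooleanSubalgebra.closure {S : Cantor m | IsMinimalSet S}

theorem continuous_smul_cantor {m : ℕ} (g : DomMulAct SInf) :
    Continuous fun φ : Cantor m => g • φ :=
  continuous_pi fun f => continuous_apply (DomMulAct.mk.symm g • f)

theorem closure_orb_invariant {m : ℕ} (φ : Cantor m) (g : DomMulAct SInf) :
    ∀ y ∈ closure (orb φ), g • y ∈ closure (orb φ) := by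
  intro y hy
  refine map_mem_closure (continuous_smul_cantor g) hy ?_
  rintro _ ⟨k, rfl⟩
  exact ⟨g * k, mul_smul g k φ⟩

theorem continuous_lift {m n : ℕ} (f : Fin m ↪ Fin n) : Continuous (lift f) :=
  continuous_pi fun s => continuous_apply (f.trans s)

theorem lift_smul {m n : ℕ} (f : Fin m ↪ Fin n) (g : DomMulAct SInf) (φ : Cantor m) :
    lift f (g • φ) = g • lift f φ := rfl

theorem image_lift_closure {m n : ℕ} (f : Fin m ↪ Fin n) (φ : Cantor m) :
    lift f '' closure (orb φ) = closure (orb (lift f φ)) := by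
  have h : lift f '' orb φ = orb (lift f φ) := by
    ext y
    constructor
    · rintro ⟨_, ⟨g, rfl⟩, rfl⟩
      exact ⟨g, rfl⟩
    · rintro ⟨g, rfl⟩
      exact ⟨g • φ, ⟨g, rfl⟩, rfl⟩
  rw [← h]
  exact (isClosed_closure.isCompact.image (continuous_lift f)).isClosed.closure_eq ▸
    (closure_image_closure (continuous_lift f))

theorem IsMinimalSet.lift {m n : ℕ} (f : Fin m ↪ Fin n) {S : Cantor m} (hS : IsMinimalSet S) :
    IsMinimalSet (lift f S) where
  nonempty := ⟨_, subset_closure (MulAction.mem_orbit_self _)⟩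
  isClosed := isClosed_closure
  invariant := closure_orb_invariant _
  dense_orbit := by
    intro y hy
    rw [← image_lift_closure] at hy
    obtain ⟨x, hx, rfl⟩ := hy
    rw [← image_lift_closure, ← image_lift_closure]
    exact Set.image_mono (hS.dense_orbit x hx)

theorem lift_mem_B {m n : ℕ} (f : Fin m ↪ Fin n) {T : Cantor m} (hT : T ∈ B m) :
    lift f T ∈ B n := by
  induction hT using BooleanSubalgebra.closure_bot_sup_induction with
  | mem x hx => exact BooleanSubalgebra.subset_closure (IsMinimalSet.lift f hx)
  | bot => exact (B n).bot_mem
  | sup x _ y _ hx hy => exact BooleanSubalgebra.sup_mem hx hy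
  | compl x _ hx => exact BooleanSubalgebra.compl_mem hx

/-- `B_m'`: the Boolean algebra of all `T ⊆ H_m` such that `i^n_m(T)` belongs to `B_n`
for some `n ≥ m`. -/
def B' (m : ℕ) : BooleanSubalgebra (Cantor m) where
  carrier := {T : Cantor m | ∃ (n : ℕ) (h : m ≤ n), lift (incl h) T ∈ B n}
  supClosed' := by
    rintro S ⟨n, hn, hS⟩ T ⟨k, hk, hT⟩
    refine ⟨max n k, hn.trans (le_max_left n k), ?_⟩
    exact BooleanSubalgebra.sup_mem (lift_mem_B (incl (le_max_left n k)) hS)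
      (lift_mem_B (incl (le_max_right n k)) hT)
  infClosed' := by
    rintro S ⟨n, hn, hS⟩ T ⟨k, hk, hT⟩
    refine ⟨max n k, hn.trans (le_max_left n k), ?_⟩
    exact BooleanSubalgebra.inf_mem (lift_mem_B (incl (le_max_left n k)) hS)
      (lift_mem_B (incl (le_max_right n k)) hT)
  compl_mem' := by
    rintro S ⟨n, hn, hS⟩
    exact ⟨n, hn, BooleanSubalgebra.compl_mem hS⟩
  bot_mem' := ⟨m, le_rfl, (B m).bot_mem⟩

end SInfFlow

/-!
Membership in a minimal subset of `H_m` is decided by linear orders, and for `m ≥ 2` there are too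
few linear orders on a finite set to produce all of its `m`-ary patterns.

*Minimal sets.* Colour each `m`-element set `A ⊆ ω` by the restriction of a subset `S` of `H_m` to
the injections with range `A`, an injection being recorded by its order pattern. Ramsey's theorem
provides arbitrarily large homogeneous sets of one fixed colour `E`; moving them to initial
segments of `ω` shows that the orbit closure of `S` contains the set `{f | E (pattern of f)}`
(`exists_ordPattern_mem_closure_orb`). If `S` is minimal, then conversely `S` is in the orbit
closure of that set. So on every finite set of points `S` is computed by `E` from the order pattern
for some linear order (`IsMinimalSet.isOrderDefinable`).

*Boolean combinations.* Finite Boolean combinations of such sets are computed, on every finite set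
of points, from order patterns for a fixed number `k` of linear orders
(`isOrderDefinable_of_mem_B`).

*Counting.* If the lift of `T ⊆ H_m` to `H_n` has this property, then the restrictions of the
translates of `T` to `A_N` number at most `((N + n) ^ (N + n)) ^ k`. If `T` has a dense orbit, all
`2 ^ (N (N - 1) ⋯ (N - m + 1))` patterns occur among them, and for `m ≥ 2` and large `N` this is
impossible (`notMem_B'_of_closure_orb_eq_univ`).

*Category.* The shift is topologically transitive on `2^{H_m}` for `m ≥ 1`, because a permutation
can move one initial segment off another, so by the Baire category theorem the points with dense
orbit form a dense `Gδ` set; its complement contains `B_m'`.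
-/

namespace SInfFlow

open Filter

/-! ### Order patterns -/

/-- The order pattern of `f : α → ℕ`: the relation on `α` obtained by pulling back `<`. -/
def ordPattern {α : Type*} (f : α → ℕ) : α → α → Prop := fun a b => f a < f b

/-- An injection of a finite type into `ℕ` is determined by its range and its order pattern. -/
theorem eq_of_ordPattern_eq {α : Type*} [Finite α] {f g : α → ℕ} (hf : Function.Injective f)
    (hr : Set.range f = Set.range g) (hp : ordPattern f = ordPattern g) : f = g := by
  let : LinearOrder α := LinearOrder.lift' f hf
  have hfm : StrictMono f := fun _ _ h => h
  have hgm : StrictMono g := fun a b h => by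
    have h' : ordPattern f a b := h
    rwa [hp] at h'
  exact (hfm.range_inj hgm).1 hr

/-- `R x` is the number of points with smaller value under `h`; thus every order pattern on `M`
points is realized with values in `Fin M`. -/
theorem exists_rank {M : ℕ} (h : Fin M → ℕ) :
    ∃ R : Fin M → Fin M, ∀ x y, h x < h y ↔ R x < R y := by
  let lower : Fin M → Finset (Fin M) := fun x => Finset.univ.filter fun z => h z < h x
  have hlt : ∀ x, (lower x).card < M := fun x => by
    conv_rhs => rw [← Fintype.card_fin M]
    exact Finset.card_lt_univ_of_notMem (x := x) (by simp [lower])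
  have hmono : ∀ x y, h x ≤ h y → lower x ⊆ lower y := fun x y hxy z hz => by
    simp only [lower, Finset.mem_filter_univ] at hz ⊢
    omega
  have key : ∀ x y, h x < h y ↔ (lower x).card < (lower y).card := fun x y => by
    refine ⟨fun hxy => Finset.card_lt_card ?_, fun hxy => ?_⟩
    · exact (Finset.ssubset_iff_of_subset (hmono x y hxy.le)).2
        ⟨x, by simpa [lower], by simp [lower]⟩
    · by_contra hn
      exact absurd hxy (not_lt.2 (Finset.card_le_card (hmono y x (not_lt.1 hn))))
  exact ⟨fun x => ⟨_, hlt x⟩, key⟩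

/-! ### Ramsey's theorem -/

theorem exists_eventually_eq {α κ : Type*} [Finite κ] (p : Ultrafilter α) (c : α → κ) :
    ∃ k, ∀ᶠ x in (p : Filter α), c x = k := by
  obtain ⟨k, hk⟩ := (p.map c).eq_pure_of_finite
  have h : {k} ∈ p.map c := by rw [hk]; exact Set.mem_singleton k
  exact ⟨k, h⟩

/-- Ramsey's theorem for `m`-element sets, with one colour serving for all sizes of the
homogeneous set. -/
theorem exists_homogeneous {κ : Type*} [Finite κ] (m : ℕ) (c : Finset ℕ → κ) :
    ∃ k, ∀ N : ℕ, ∃ X : Finset ℕ, X.card = N ∧ ∀ A ⊆ X, A.card = m → c A = k := by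
  classical
  let p := hyperfilter ℕ
  choose next hnext using fun d : Finset ℕ → κ => fun A : Finset ℕ =>
    exists_eventually_eq p fun x => d (insert x A)
  -- `d i` is the `i`-fold iterated limit of `c` along `p`.
  let d : ℕ → Finset ℕ → κ := fun i => next^[i] c
  have hd : ∀ i A, ∀ᶠ x in (p : Filter ℕ), d i (insert x A) = d (i + 1) A := fun i A => by
    simpa only [d, Function.iterate_succ_apply'] using hnext (d i) A
  -- Grow `X` so that on each `A ⊆ X` the iterated limit leading up to `m` points has the same
  -- value; the next point has to satisfy only finitely many `p`-almost sure conditions.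
  have key : ∀ N : ℕ, ∃ X : Finset ℕ, X.card = N ∧
      ∀ A ⊆ X, ∀ i, A.card + i = m → d i A = d m ∅ := by
    intro N
    induction N with
    | zero =>
      refine ⟨∅, rfl, fun A hA i hi => ?_⟩
      obtain rfl := Finset.subset_empty.1 hA
      simp only [Finset.card_empty, zero_add] at hi
      rw [hi]
    | succ N ih =>
      obtain ⟨X, hX, hXd⟩ := ih
      have h1 : ∀ᶠ x in (p : Filter ℕ), x ∉ X :=
        compl_mem_hyperfilter_of_finite X.finite_toSet
      have h2 : ∀ᶠ x in (p : Filter ℕ), ∀ A ∈ X.powerset, ∀ i ∈ Finset.range m,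
          d i (insert x A) = d (i + 1) A :=
        (eventually_all_finset _).2 fun A _ => (eventually_all_finset _).2 fun i _ => hd i A
      obtain ⟨x, hxX, hx⟩ := (h1.and h2).exists
      refine ⟨insert x X, by rw [Finset.card_insert_of_notMem hxX, hX], fun A hA i hi => ?_⟩
      by_cases hxA : x ∈ A
      · have hcard := Finset.card_erase_add_one hxA
        have hsub : A.erase x ⊆ X := by rwa [← Finset.subset_insert_iff]
        rw [← Finset.insert_erase hxA, hx _ (Finset.mem_powerset.2 hsub) i
          (Finset.mem_range.2 (by omega))]
        exact hXd _ hsub _ (by omega)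
      · exact hXd A ((Finset.subset_insert_iff_of_notMem hxA).1 hA) i hi
  refine ⟨d m ∅, fun N => ?_⟩
  obtain ⟨X, hX, h⟩ := key N
  exact ⟨X, hX, fun A hA hAm => h A hA 0 hAm⟩

/-! ### The topology of the shift -/

/-- The injections `A_m → ω` with values in `A_N`. -/
def below (m N : ℕ) : Set (H m) := {f | ∀ a, f a < N}

theorem finite_below (m N : ℕ) : (below m N).Finite := by
  have h : (Set.univ.pi fun _ : Fin m => Set.Iio N).Finite :=
    Set.Finite.pi fun _ => Set.finite_Iio N
  refine (h.preimage (DFunLike.coe_injective (F := H m)).injOn).subset fun f hf a _ => hf a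

theorem exists_subset_below {m : ℕ} (I : Finset (H m)) : ∃ N, (I : Set (H m)) ⊆ below m N := by
  refine ⟨I.sup (fun f => Finset.univ.sup fun a => f a) + 1, fun f hf a => ?_⟩
  refine Nat.lt_succ_of_le (le_trans ?_ (Finset.le_sup (f := fun f : H m =>
    Finset.univ.sup fun a => f a) hf))
  exact Finset.le_sup (f := fun a => f a) (Finset.mem_univ a)

theorem exists_eqOn_below_subset {m : ℕ} {U : Set (Cantor m)} (hU : IsOpen U) {x : Cantor m}
    (hx : x ∈ U) : ∃ N, ∀ y, Set.EqOn y x (below m N) → y ∈ U := by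
  obtain ⟨I, u, hu, hI⟩ := isOpen_pi_iff.1 hU x hx
  obtain ⟨N, hN⟩ := exists_subset_below I
  refine ⟨N, fun y hy => hI fun f hf => ?_⟩
  rw [hy (hN hf)]
  exact (hu f hf).2

theorem isOpen_setOf_eqOn_below {m : ℕ} (x : Cantor m) (N : ℕ) :
    IsOpen {y : Cantor m | Set.EqOn y x (below m N)} := by
  have h : {y : Cantor m | Set.EqOn y x (below m N)} = (below m N).pi fun f => {x f} := by
    ext y
    simp [Set.EqOn, Set.mem_pi]
  rw [h]
  exact isOpen_set_pi (finite_below m N) fun _ _ => isOpen_discrete _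

theorem mem_closure_orb_iff {m : ℕ} {x y : Cantor m} :
    x ∈ closure (orb y) ↔
      ∀ N, ∃ g : SInf, ∀ f ∈ below m N, x f = y (f.trans g.toEmbedding) := by
  constructor
  · intro hx N
    obtain ⟨_, hz, ⟨g, rfl⟩⟩ := mem_closure_iff.1 hx _ (isOpen_setOf_eqOn_below x N)
      (fun _ _ => rfl)
    exact ⟨DomMulAct.mk.symm g, fun f hf => (hz hf).symm⟩
  · intro h
    refine mem_closure_iff.2 fun U hU hxU => ?_
    obtain ⟨N, hN⟩ := exists_eqOn_below_subset hU hxU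
    obtain ⟨g, hg⟩ := h N
    exact ⟨DomMulAct.mk g • y, hN _ fun f hf => (hg f hf).symm, DomMulAct.mk g, rfl⟩

theorem exists_perm_extending {N : ℕ} (e : Fin N ↪ ℕ) : ∃ g : SInf, ∀ x : Fin N, g x = e x := by
  obtain ⟨g, hg⟩ := (MulAction.isMultiplyPretransitive_iff (G := SInf) (α := ℕ)).1
    (Equiv.Perm.isMultiplyPretransitive ℕ N) Fin.valEmbedding e
  exact ⟨g, fun x => by rw [← hg]; rfl⟩

/-- Topological transitivity of the shift; it fails for `m = 0`, where the action is trivial. -/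
theorem exists_smul_mem_of_isOpen {m : ℕ} (hm : 0 < m) {U V : Set (Cantor m)} (hU : IsOpen U)
    (hU' : U.Nonempty) (hV : IsOpen V) (hV' : V.Nonempty) :
    ∃ T ∈ V, ∃ g : DomMulAct SInf, g • T ∈ U := by
  classical
  obtain ⟨x, hx⟩ := hU'
  obtain ⟨y, hy⟩ := hV'
  obtain ⟨N, hN⟩ := exists_eqOn_below_subset hU hx
  obtain ⟨M, hM⟩ := exists_eqOn_below_subset hV hy
  -- A permutation moving `A_N` off `A_M`.
  obtain ⟨g, hg⟩ := exists_perm_extending (Fin.valEmbedding.trans (addRightEmbedding M) : Fin N ↪ ℕ)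
  let T : Cantor m := fun f => if f ∈ below m M then y f else x (f.trans g.symm.toEmbedding)
  refine ⟨T, hM _ fun f hf => if_pos hf, DomMulAct.mk g, hN _ fun f hf => ?_⟩
  rw [shift_apply]
  have hnot : f.trans g.toEmbedding ∉ below m M := fun h => by
    have h0 : g (f ⟨0, hm⟩) < M := h ⟨0, hm⟩
    have h1 : g (f ⟨0, hm⟩) = f ⟨0, hm⟩ + M := hg ⟨_, hf ⟨0, hm⟩⟩
    omega
  refine (if_neg hnot).trans (congrArg x ?_)
  ext a
  simp

instance countable_H (m : ℕ) : Countable (H m) :=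
  (DFunLike.coe_injective (F := H m)).countable

theorem setOf_closure_orb_eq_univ_eq {m : ℕ} :
    {T : Cantor m | closure (orb T) = Set.univ} =
      ⋂ U ∈ TopologicalSpace.countableBasis (Cantor m), ⋃ g : DomMulAct SInf,
        (fun T => g • T) ⁻¹' U := by
  ext T
  rw [Set.mem_ofPred_eq, ← dense_iff_closure_eq,
    (TopologicalSpace.isBasis_countableBasis (Cantor m)).dense_iff]
  simp only [Set.mem_iInter, Set.mem_iUnion, Set.mem_preimage]
  constructor
  · intro h U hU
    obtain ⟨_, hz, ⟨g, rfl⟩⟩ := h U hU (TopologicalSpace.nonempty_of_mem_countableBasis hU)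
    exact ⟨g, hz⟩
  · intro h U hU _
    obtain ⟨g, hg⟩ := h U hU
    exact ⟨_, hg, g, rfl⟩

theorem isOpen_iUnion_preimage_smul {m : ℕ} {U : Set (Cantor m)} (hU : IsOpen U) :
    IsOpen (⋃ g : DomMulAct SInf, (fun T => g • T) ⁻¹' U) :=
  isOpen_iUnion fun g => hU.preimage (continuous_smul_cantor g)

theorem isGδ_setOf_closure_orb_eq_univ (m : ℕ) :
    IsGδ {T : Cantor m | closure (orb T) = Set.univ} := by
  rw [setOf_closure_orb_eq_univ_eq]
  exact IsGδ.biInter_of_isOpen (TopologicalSpace.countable_countableBasis _) fun U hU =>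
    isOpen_iUnion_preimage_smul (TopologicalSpace.isOpen_of_mem_countableBasis hU)

theorem dense_setOf_closure_orb_eq_univ {m : ℕ} (hm : 0 < m) :
    Dense {T : Cantor m | closure (orb T) = Set.univ} := by
  rw [setOf_closure_orb_eq_univ_eq]
  refine dense_biInter_of_isOpen (fun U hU => isOpen_iUnion_preimage_smul
    (TopologicalSpace.isOpen_of_mem_countableBasis hU))
    (TopologicalSpace.countable_countableBasis _) fun U hU => ?_
  refine dense_iff_inter_open.2 fun V hV hV' => ?_
  obtain ⟨T, hT, g, hg⟩ := exists_smul_mem_of_isOpen hm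
    (TopologicalSpace.isOpen_of_mem_countableBasis hU)
    (TopologicalSpace.nonempty_of_mem_countableBasis hU) hV hV'
  exact ⟨T, hT, Set.mem_iUnion.2 ⟨g, hg⟩⟩

/-! ### Minimal sets are computed from order patterns -/

/-- Every orbit closure contains a set that is defined by order patterns for the usual order
of `ω`. -/
theorem exists_ordPattern_mem_closure_orb {m : ℕ} (y : Cantor m) :
    ∃ E : (Fin m → Fin m → Prop) → Bool,
      (fun f : H m => E (ordPattern f)) ∈ closure (orb y) := by
  classical
  -- The colour of `A` is `y` on the injections with range `A`, as a function of the order pattern.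
  let c : Finset ℕ → (Fin m → Fin m → Prop) → Bool := fun A P =>
    decide (∃ f : H m, Set.range f = A ∧ ordPattern f = P ∧ y f = true)
  have hc : ∀ (f : H m) (A : Finset ℕ), Set.range f = A → c A (ordPattern f) = y f := by
    intro f A hA
    have h : (∃ f' : H m, Set.range f' = A ∧ ordPattern f' = ordPattern f ∧ y f' = true) ↔
        y f = true := by
      constructor
      · rintro ⟨f', hr, hp, hy⟩
        rwa [DFunLike.coe_injective (eq_of_ordPattern_eq f'.injective (hr.trans hA.symm) hp)] at hy
      · exact fun hy => ⟨f, hA, rfl, hy⟩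
    simp only [c, h, Bool.decide_eq_true]
  obtain ⟨E, hE⟩ := exists_homogeneous m c
  refine ⟨E, mem_closure_orb_iff.2 fun N => ?_⟩
  obtain ⟨X, hX, hXE⟩ := hE N
  obtain ⟨g, hg⟩ := exists_perm_extending (X.orderEmbOfFin hX).toEmbedding
  refine ⟨g, fun f hf => ?_⟩
  have hgf : ∀ a, g (f a) = X.orderEmbOfFin hX ⟨f a, hf a⟩ := fun a => hg ⟨f a, hf a⟩
  have hp : ordPattern (f.trans g.toEmbedding) = ordPattern f := by
    ext a b
    simp [ordPattern, hgf]
  let A : Finset ℕ := Finset.univ.map (f.trans g.toEmbedding)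
  have hA : Set.range (f.trans g.toEmbedding) = A := by
    rw [Finset.coe_map, Finset.coe_univ, Set.image_univ]
  have hAX : A ⊆ X := fun x hx => by
    obtain ⟨a, -, rfl⟩ := Finset.mem_map.1 hx
    change g (f a) ∈ X
    rw [hgf]
    exact X.orderEmbOfFin_mem hX _
  rw [← hc _ A hA, hXE A hAX (by simp [A]), hp]

/-- `T ⊆ H_n` is order definable if there are a finite index set `ι` and a Boolean function `E` of
`ι`-tuples of order patterns such that, on injections into any given initial segment of `ω`,
`T` is `E` of the order patterns for some `ι`-tuple of linear orders. The orders, encoded by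
permutations of `ω`, may depend on the initial segment, while `ι` and `E` do not. -/
def IsOrderDefinable {n : ℕ} (T : Cantor n) : Prop :=
  ∃ (ι : Type) (_ : Finite ι) (E : (ι → Fin n → Fin n → Prop) → Bool),
    ∀ N, ∃ r : ι → SInf, ∀ f ∈ below n N, T f = E fun i => ordPattern (r i ∘ f)

theorem IsMinimalSet.isOrderDefinable {n : ℕ} {S : Cantor n} (hS : IsMinimalSet S) :
    IsOrderDefinable S := by
  obtain ⟨E, hE⟩ := exists_ordPattern_mem_closure_orb S
  have hmem := hS.dense_orbit _ hE (subset_closure (MulAction.mem_orbit_self S))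
  refine ⟨Unit, inferInstance, fun P => E (P ()), fun N => ?_⟩
  obtain ⟨g, hg⟩ := mem_closure_orb_iff.1 hmem N
  exact ⟨fun _ => g, hg⟩

theorem IsOrderDefinable.compl {n : ℕ} {T : Cantor n} (hT : IsOrderDefinable T) :
    IsOrderDefinable Tᶜ := by
  obtain ⟨ι, hι, E, h⟩ := hT
  refine ⟨ι, hι, fun P => !(E P), fun N => ?_⟩
  obtain ⟨r, hr⟩ := h N
  exact ⟨r, fun f hf => congrArg (! ·) (hr f hf)⟩

theorem IsOrderDefinable.sup {n : ℕ} {S T : Cantor n} (hS : IsOrderDefinable S)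
    (hT : IsOrderDefinable T) : IsOrderDefinable (S ⊔ T) := by
  obtain ⟨ι, hι, E, h⟩ := hS
  obtain ⟨κ, hκ, F, k⟩ := hT
  refine ⟨ι ⊕ κ, inferInstance, fun P => E (fun i => P (.inl i)) || F (fun j => P (.inr j)),
    fun N => ?_⟩
  obtain ⟨r, hr⟩ := h N
  obtain ⟨s, hs⟩ := k N
  exact ⟨Sum.elim r s, fun f hf => congrArg₂ (· || ·) (hr f hf) (hs f hf)⟩

theorem isOrderDefinable_of_mem_B {n : ℕ} {T : Cantor n} (hT : T ∈ B n) : IsOrderDefinable T := by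
  induction hT using BooleanSubalgebra.closure_bot_sup_induction with
  | mem x hx => exact IsMinimalSet.isOrderDefinable hx
  | bot => exact ⟨Empty, inferInstance, fun _ => false, fun N => ⟨Empty.elim, fun _ _ => rfl⟩⟩
  | sup x _ y _ hx hy => exact hx.sup hy
  | compl x _ hx => exact hx.compl

/-! ### Counting patterns -/

/-- Extend an injection `A_m → A_N` to an injection `A_n → A_{N + n}` by new values on the points
outside `A_m`. -/
def extendEmb {m N : ℕ} (n : ℕ) (f : Fin m ↪ Fin N) : Fin n ↪ Fin (N + n) where
  toFun a := if h : (a : ℕ) < m then Fin.castAdd n (f ⟨a, h⟩) else Fin.natAdd N a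
  inj' := by
    intro a b hab
    dsimp only at hab
    split_ifs at hab with ha hb hb
    · have := f.injective (Fin.castAdd_injective N n hab)
      simpa [Fin.ext_iff] using this
    · have := (f ⟨a, ha⟩).isLt
      simp only [Fin.ext_iff, Fin.val_castAdd, Fin.val_natAdd] at hab
      omega
    · have := (f ⟨b, hb⟩).isLt
      simp only [Fin.ext_iff, Fin.val_castAdd, Fin.val_natAdd] at hab
      omega
    · simpa [Fin.ext_iff] using hab

theorem incl_trans_extendEmb {m n N : ℕ} (h : m ≤ n) (f : Fin m ↪ Fin N) (a : Fin m) :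
    extendEmb n f (incl h a) = Fin.castAdd n (f a) := by
  exact dif_pos a.isLt

/-- For `m ≥ 2` there are more subsets of the set of injections `A_m → A_N` than `k`-tuples of
self-maps of `A_{N + n}`. -/
theorem exists_pow_lt_two_pow_descFactorial {m n : ℕ} (hm : 2 ≤ m) (h : m ≤ n) (k : ℕ) :
    ∃ N, ((N + n) ^ (N + n)) ^ k < 2 ^ N.descFactorial m := by
  -- Take `N + n = 2 ^ j` with `j` so large that `k j 2 ^ j < (2 ^ (j - 1)) ^ 2`.
  obtain ⟨j, hj1, hj2⟩ : ∃ j : ℕ, 4 * n ≤ 2 ^ j ∧ 4 * k * j < 2 ^ j := by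
    have h1 : ∀ᶠ j : ℕ in atTop, 4 * n ≤ 2 ^ j :=
      (tendsto_pow_atTop_atTop_of_one_lt one_lt_two).eventually_ge_atTop _
    have h2 : ∀ᶠ j : ℕ in atTop, 4 * k * j < 2 ^ j := by
      have ht := tendsto_pow_const_div_const_pow_of_one_lt 1 (one_lt_two (α := ℝ))
      have hpos : (0 : ℝ) < 1 / (4 * k + 1) := by positivity
      filter_upwards [ht.eventually_lt_const hpos] with j hj
      rw [pow_one, div_lt_div_iff₀ (by positivity) (by positivity)] at hj
      have hj' : j * (4 * k + 1) < 1 * 2 ^ j := by exact_mod_cast hj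
      nlinarith
    exact (h1.and h2).exists
  refine ⟨2 ^ j - n, ?_⟩
  have hM : 2 ^ j - n + n = 2 ^ j := by omega
  rw [hM, ← pow_mul, ← pow_mul]
  refine Nat.pow_lt_pow_right one_lt_two ?_
  refine lt_of_lt_of_le ?_ (Nat.pow_sub_le_descFactorial (2 ^ j - n) m)
  have hb : 2 ^ j ≤ 2 * (2 ^ j - n + 1 - m) := by omega
  set b := 2 ^ j - n + 1 - m
  have hb0 : 0 < b := by have := Nat.two_pow_pos j; omega
  refine lt_of_lt_of_le ?_ (Nat.pow_le_pow_right hb0 hm)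
  have hj0 := Nat.two_pow_pos j
  have e : 4 * (j * (2 ^ j * k)) < 2 ^ j * 2 ^ j := by nlinarith
  nlinarith

theorem notMem_B'_of_closure_orb_eq_univ {m : ℕ} (hm : 2 ≤ m) {T : Cantor m}
    (hT : closure (orb T) = Set.univ) : T ∉ B' m := by
  classical
  rintro ⟨n, hmn, hB⟩
  obtain ⟨ι, hι, E, hE⟩ := isOrderDefinable_of_mem_B hB
  have := Fintype.ofFinite ι
  obtain ⟨N, hN⟩ := exists_pow_lt_two_pow_descFactorial hm hmn (Fintype.card ι)
  let Φ : (ι → Fin (N + n) → Fin (N + n)) → (Fin m ↪ Fin N) → Bool := fun R f =>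
    E fun i a b => R i (extendEmb n f a) < R i (extendEmb n f b)
  have hΦ : Function.Surjective Φ := by
    intro p
    -- The pattern `p` occurs in `T` along the first `N` values of a permutation `g`.
    let y : Cantor m := fun f => if hf : ∃ f' : Fin m ↪ Fin N, f'.trans Fin.valEmbedding = f then
      p hf.choose else false
    have hy : ∀ f : Fin m ↪ Fin N, y (f.trans Fin.valEmbedding) = p f := by
      intro f
      have hf : ∃ f' : Fin m ↪ Fin N, f'.trans Fin.valEmbedding = f.trans Fin.valEmbedding :=
        ⟨f, rfl⟩
      refine (dif_pos hf).trans (congrArg p ?_)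
      ext a
      exact DFunLike.congr_fun hf.choose_spec a
    obtain ⟨g, hg⟩ := mem_closure_orb_iff.1 (hT ▸ Set.mem_univ y) N
    let s : (Fin m ↪ Fin N) → H n := fun f =>
      ((extendEmb n f).trans Fin.valEmbedding).trans g.toEmbedding
    obtain ⟨K, hK⟩ := exists_subset_below (Finset.univ.image s)
    obtain ⟨r, hr⟩ := hE K
    choose R hR using fun i => exists_rank fun x : Fin (N + n) => r i (g x)
    refine ⟨R, funext fun f => ?_⟩
    have h1 : T ((incl hmn).trans (s f)) = E fun i => ordPattern (r i ∘ s f) :=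
      hr (s f) (hK (by simp))
    have h2 : (incl hmn).trans (s f) = (f.trans Fin.valEmbedding).trans g.toEmbedding := by
      ext a
      change g (extendEmb n f (incl hmn a) : ℕ) = g (f a)
      rw [incl_trans_extendEmb]
      rfl
    rw [← hy f, hg _ fun a => (f a).isLt, ← h2, h1]
    refine congrArg E (funext fun i => funext fun a => funext fun b => propext ?_)
    exact (hR i _ _).symm
  have hcard := Fintype.card_le_of_surjective Φ hΦ
  simp only [Fintype.card_fun, Fintype.card_fin, Fintype.card_bool, Fintype.card_embedding_eq]
    at hcard
  exact absurd hcard (not_le.2 hN)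

end SInfFlow

theorem mainTheorem5 (m : ℕ) (hm : 2 ≤ m) :
    IsMeagre (SInfFlow.B' m : Set (SInfFlow.Cantor m)) ∧
    IsGδ {T : SInfFlow.Cantor m | closure (SInfFlow.orb T) = Set.univ} ∧
    Dense {T : SInfFlow.Cantor m | closure (SInfFlow.orb T) = Set.univ} ∧
    ∀ T : SInfFlow.Cantor m, closure (SInfFlow.orb T) = Set.univ → T ∉ SInfFlow.B' m := by
  have hG := SInfFlow.isGδ_setOf_closure_orb_eq_univ m
  have hD := SInfFlow.dense_setOf_closure_orb_eq_univ (by omega : 0 < m)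
  have hN : ∀ T : SInfFlow.Cantor m, closure (SInfFlow.orb T) = Set.univ → T ∉ SInfFlow.B' m :=
    fun T hT => SInfFlow.notMem_B'_of_closure_orb_eq_univ hm hT
  exact ⟨Filter.mem_of_superset (residual_of_dense_Gδ hG hD) hN, hG, hD, hN⟩
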